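/- Let $G=(V,E)$ be any simple graph. Write $G$ also for its 1-complex, in which every edge is a copy of $[0,1]$ joining its two endvertices and a set is open if and only if its trace on every edge is open in $[0,1]$; let $\beta G$ be the Stone–Čech compactification of this space and $G^*=\beta G\setminus G$ its remainder. For a vertex $v$ let $S(v)\subseteq G$ consist of $v$ and all closed edges at $v$, let $N(v)$ be the set of neighbours of $v$, and put $$O_{\beta G}(v)=\overline{S(v)}^{\,\beta G}\setminus\overline{N(v)}^{\,\beta G},\qquad G^\times=\beta G\setminus\bigcup_{v\in V}O_{\beta G}(v).$$ Let $\approx_*$ and $\approx_\times$ be the equivalence relations on the spaces $G^*$ and $G^\times$ whose classes are their connected components, and give $G^*/{\approx_*}$ and $G^\times/{\approx_\times}$ the quotient topologies. Then $G^\times\subseteq G^*$, and the map $C\mapsto\hat C$, sending a component $C$ of $G^\times$ to the component $\hat C$ of $G^*$ that contains it, is a homeomorphism $G^\times/{\approx_\times}\to G^*/{\approx_*}$. Moreover, both quotients are Hausdorff. -/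

import Mathlib

namespace SimpleGraph

variable {V : Type*} (G : SimpleGraph V)

/-- The identifications that build the 1-complex of `G` from its vertices and one copy of `[0, 1]`
for every oriented edge `d`: the point `0` of `d` is the first endvertex of `d`, and the two
orientations of an edge give the same copy of `[0, 1]`, run through in opposite directions. -/
inductive OneComplexRel : V ⊕ (G.Dart × unitInterval) → V ⊕ (G.Dart × unitInterval) → Prop
  | source (d : G.Dart) : OneComplexRel (Sum.inr (d, 0)) (Sum.inl d.fst)
  | reverse (d : G.Dart) (t : unitInterval) :
      OneComplexRel (Sum.inr (d, t)) (Sum.inr (d.symm, unitInterval.symm t))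

/-- The 1-complex of a graph: every edge is a copy of `[0, 1]` joining its endvertices. -/
def OneComplex : Type _ := Quot G.OneComplexRel

namespace OneComplex

/-- A vertex as a point of the 1-complex. -/
def vertex (v : V) : G.OneComplex := Quot.mk _ (Sum.inl v)

variable {G} in
/-- The point at parameter `t` on the (oriented) edge `d`; it is `d.fst` for `t = 0` and `d.snd` for
`t = 1`. -/
def edgePoint (d : G.Dart) (t : unitInterval) : G.OneComplex := Quot.mk _ (Sum.inr (d, t))

/-- The quotient topology, where the set of vertices and the set of oriented edges are discrete: a
set is open if and only if its trace on every edge is open in `[0, 1]`. -/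
instance : TopologicalSpace G.OneComplex :=
  ⨆ d : G.Dart, TopologicalSpace.coinduced (edgePoint d) inferInstance

theorem isOpen_iff (U : Set G.OneComplex) :
    IsOpen U ↔ ∀ d : G.Dart, IsOpen {t : unitInterval | edgePoint d t ∈ U} := by
  refine isOpen_iSup_iff.trans (forall_congr' fun d => ?_)
  exact isOpen_coinduced

/-- `⋃ E(v)`: the vertex `v` with all (closed) edges at `v`. Naming `v` separately matters only if
`v` is isolated. -/
def star (v : V) : Set G.OneComplex :=
  {vertex G v} ∪ {p | ∃ (d : G.Dart) (t : unitInterval), d.fst = v ∧ p = edgePoint d t}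

/-- `N(v)`: the neighbours of `v`, as points of the 1-complex. -/
def neighbors (v : V) : Set G.OneComplex := vertex G '' G.neighborSet v

end OneComplex

/-- The Stone-Čech remainder `G* = βG \ G`. -/
def stoneCechRemainder : Set (StoneCech G.OneComplex) :=
  (Set.range (stoneCechUnit : G.OneComplex → StoneCech G.OneComplex))ᶜ

/-- `O_{βG}(v)`: the closure in `βG` of the star of `v`, minus the closure in `βG` of `N(v)`. -/
def stoneCechStar (v : V) : Set (StoneCech G.OneComplex) :=
  closure (stoneCechUnit '' OneComplex.star G v) \
    closure (stoneCechUnit '' OneComplex.neighbors G v)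

/-- The auxiliary remainder `G^× = βG \ ⋃ v, O_{βG}(v)`. -/
def auxiliaryRemainder : Set (StoneCech G.OneComplex) :=
  (⋃ v : V, G.stoneCechStar v)ᶜ

end SimpleGraph

/-- A point `C` of the quotient `ConnectedComponents A` of a subspace `A ⊆ X`, as a subset of `X`: a
connected component of `A`. -/
def ConnectedComponents.toSetIn {X : Type*} [TopologicalSpace X] {A : Set X}
    (C : ConnectedComponents A) : Set X :=
  Subtype.val '' {a : A | ConnectedComponents.mk a = C}

/-! The 1-complex is T1 and normal, so in `βG` closures of closed sets commute with finite
intersections, and subgraphs can be handled through the closures of their subcomplexes. Since `S(v)`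
and `G - v` cover `G` and meet in `N(v)`, the set `O(v)` is the complement of the closure of `G -
v`. Hence `G^×` is compact, and its points lie in the closure of `G - X` for every finite `X`.

Injectivity (`exists_isClopen_separating`): distinct components of the compact space `G^×` are
separated by a clopen partition, which extends to disjoint open sets of `βG`. By compactness these
cover `G - X` for some finite `X`. Edges are connected, so `G - X` splits into two vertex sets with
no edge between them, and this splits `G^*` into two clopen sets.

Surjectivity (`exists_auxiliaryRemainder_mk_eq`): a point of `G^*` in `O(v)` lies in the closure of
a union of final segments of the edges at `v`. Its component there stays in `G^*` and reaches the
closure of `N(v)`, whose points in `G^*` belong to `G^×`.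

The clopen separation also makes the components of `G^*` a Hausdorff space, so the continuous
bijection from a compact space is a homeomorphism. -/

open Set Topology

/-! ### Closed subsets of a normal space and their closures in `βX` -/

section StoneCechNormal

variable {X : Type*} [TopologicalSpace X] [NormalSpace X]

/-- A Urysohn function for `P` and `Q` extends to `βX` and still separates the closures. -/
theorem disjoint_closure_stoneCechUnit_image {P Q : Set X} (hP : IsClosed P) (hQ : IsClosed Q)
    (h : Disjoint P Q) :
    Disjoint (closure (stoneCechUnit '' P)) (closure (stoneCechUnit '' Q)) := by
  obtain ⟨f, hf0, hf1, hf⟩ := exists_continuous_zero_one_of_isClosed hP hQ h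
  let g : X → unitInterval := fun x => ⟨f x, hf x⟩
  have hg : Continuous g := f.continuous.subtype_mk _
  have hE := continuous_stoneCechExtend hg
  have hext : ∀ x, stoneCechExtend hg (stoneCechUnit x) = g x :=
    fun x => congrFun (stoneCechExtend_extends hg) x
  have h0 : closure (stoneCechUnit '' P) ⊆ stoneCechExtend hg ⁻¹' {0} := by
    refine closure_minimal ?_ (isClosed_singleton.preimage hE)
    rintro _ ⟨x, hx, rfl⟩
    exact (hext x).trans (Subtype.ext (hf0 hx))
  have h1 : closure (stoneCechUnit '' Q) ⊆ stoneCechExtend hg ⁻¹' {1} := by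
    refine closure_minimal ?_ (isClosed_singleton.preimage hE)
    rintro _ ⟨x, hx, rfl⟩
    exact (hext x).trans (Subtype.ext (hf1 hx))
  refine Disjoint.mono h0 h1 (Disjoint.preimage _ ?_)
  simp

theorem closure_stoneCechUnit_image_inter {P Q : Set X} (hP : IsClosed P) (hQ : IsClosed Q) :
    closure (stoneCechUnit '' (P ∩ Q)) =
      closure (stoneCechUnit '' P) ∩ closure (stoneCechUnit '' Q) := by
  refine Subset.antisymm (subset_inter (closure_mono (image_mono inter_subset_left))
    (closure_mono (image_mono inter_subset_right))) ?_
  rintro x ⟨hxP, hxQ⟩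
  -- Cutting `P` and `Q` down to a closed neighbourhood `N` of `x` that misses the image of `P ∩ Q`
  -- makes them disjoint, yet `x` remains in both closures.
  by_contra hx
  obtain ⟨N, hN, hNc, hNs⟩ := exists_mem_nhds_isClosed_subset
    (isClosed_closure.isOpen_compl.mem_nhds hx)
  have key : ∀ R : Set X, x ∈ closure (stoneCechUnit '' R) →
      x ∈ closure (stoneCechUnit '' (R ∩ stoneCechUnit ⁻¹' N)) := by
    intro R hR
    rw [image_inter_preimage]
    exact mem_closure_iff_nhds.2 fun t ht => by
      obtain ⟨y, ⟨hyt, hyN⟩, hyR⟩ := mem_closure_iff_nhds.1 hR _ (Filter.inter_mem ht hN)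
      exact ⟨y, hyt, hyR, hyN⟩
  have hNX : IsClosed (stoneCechUnit ⁻¹' N : Set X) := hNc.preimage continuous_stoneCechUnit
  refine Set.disjoint_left.1 (disjoint_closure_stoneCechUnit_image (hP.inter hNX) (hQ.inter hNX) ?_)
    (key P hxP) (key Q hxQ)
  refine Set.disjoint_left.2 fun y hy hy' => hNs hy.2 (subset_closure ⟨y, ⟨hy.1, hy'.1⟩, rfl⟩)

theorem stoneCechUnit_mem_closure_image [T1Space X] {P : Set X} (hP : IsClosed P) {x : X} :
    stoneCechUnit x ∈ closure (stoneCechUnit '' P) ↔ x ∈ P := by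
  refine ⟨fun h => ?_, fun h => subset_closure ⟨x, h, rfl⟩⟩
  by_contra hx
  exact Set.disjoint_left.1 (disjoint_closure_stoneCechUnit_image isClosed_singleton hP
    (disjoint_singleton_left.2 hx)) (subset_closure ⟨x, rfl, rfl⟩) h

end StoneCechNormal

/-! ### The 1-complex: equality of points, T1, normality -/

namespace SimpleGraph.OneComplex

variable {V : Type*} {G : SimpleGraph V}

open unitInterval

theorem edgePoint_zero (d : G.Dart) : edgePoint d 0 = vertex G d.fst :=
  Quot.sound (.source d)

theorem edgePoint_symm (d : G.Dart) (t : I) : edgePoint d.symm (σ t) = edgePoint d t :=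
  (Quot.sound (.reverse d t)).symm

theorem edgePoint_one (d : G.Dart) : edgePoint d 1 = vertex G d.snd := by
  rw [← edgePoint_symm, symm_one, edgePoint_zero]; rfl

theorem ind {p : G.OneComplex → Prop} (hv : ∀ v, p (vertex G v))
    (he : ∀ d t, p (edgePoint d t)) (x : G.OneComplex) : p x := by
  obtain ⟨v | ⟨d, t⟩⟩ := x
  · exact hv v
  · exact he d t

/-- A function on the 1-complex, given by its values on the vertices and along the edges. -/
def lift {α : Type*} (f : V → α) (g : G.Dart → I → α) (h0 : ∀ d, g d 0 = f d.fst)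
    (hs : ∀ d t, g d t = g d.symm (σ t)) : G.OneComplex → α :=
  Quot.lift (Sum.elim f fun x => g x.1 x.2) (by
    rintro _ _ (d | ⟨d, t⟩)
    · exact h0 d
    · exact hs d t)

theorem continuous_edgePoint (d : G.Dart) : Continuous (edgePoint d) :=
  continuous_iSup_rng (i := d) continuous_coinduced_rng

theorem continuous_iff {α : Type*} [TopologicalSpace α] {f : G.OneComplex → α} :
    Continuous f ↔ ∀ d, Continuous fun t => f (edgePoint d t) :=
  continuous_iSup_dom.trans (forall_congr' fun _ => continuous_coinduced_dom)

theorem isClosed_iff (C : Set G.OneComplex) :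
    IsClosed C ↔ ∀ d : G.Dart, IsClosed {t : I | edgePoint d t ∈ C} := by
  rw [← isOpen_compl_iff, isOpen_iff]
  exact forall_congr' fun d => isOpen_compl_iff (s := {t : I | edgePoint d t ∈ C})

/-- A subset of the 1-complex, given by its vertices and its traces on the edges. -/
def ofTraces (P : V → Prop) (Q : G.Dart → I → Prop) (h0 : ∀ d, Q d 0 ↔ P d.fst)
    (hs : ∀ d t, Q d t ↔ Q d.symm (σ t)) : Set G.OneComplex :=
  {x | lift P Q (fun d => propext (h0 d)) (fun d t => propext (hs d t)) x}

theorem edgePoint_eq_vertex_iff (d : G.Dart) (t : I) (w : V) :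
    edgePoint d t = vertex G w ↔ t = 0 ∧ d.fst = w ∨ t = 1 ∧ d.snd = w := by
  constructor
  · intro h
    -- Equality in the quotient is read off from a set defined by compatible traces, here the
    -- singleton of `w`.
    let S : Set G.OneComplex := ofTraces (· = w)
      (fun d t => t = 0 ∧ d.fst = w ∨ t = 1 ∧ d.snd = w) (by simp)
      (by intro d t; simp [or_comm])
    have : vertex G w ∈ S := show w = w from rfl
    rw [← h] at this
    exact this
  · rintro (⟨rfl, rfl⟩ | ⟨rfl, rfl⟩)
    · exact edgePoint_zero d
    · exact edgePoint_one d

theorem edgePoint_eq_edgePoint {d e : G.Dart} {s t : I} (h : edgePoint d t = edgePoint e s)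
    (h0 : s ≠ 0) (h1 : s ≠ 1) : d = e ∧ t = s ∨ d = e.symm ∧ t = σ s := by
  let S : Set G.OneComplex := ofTraces (fun _ => False)
    (fun d t => d = e ∧ t = s ∨ d = e.symm ∧ t = σ s)
    (by intro d; simp [h0.symm, h1, eq_comm (a := (0 : I))])
    (by
      intro d t
      have h1 : d.symm = e ↔ d = e.symm :=
        ⟨fun h => by rw [← h, Dart.symm_symm], fun h => by rw [h, Dart.symm_symm]⟩
      have h2 : d.symm = e.symm ↔ d = e := Dart.symm_involutive.injective.eq_iff
      have h3 : σ t = s ↔ t = σ s :=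
        ⟨fun h => by rw [← h, symm_symm], fun h => by rw [h, symm_symm]⟩
      have h4 : σ t = σ s ↔ t = s := symm_bijective.injective.eq_iff
      rw [h1, h2, h3, h4, or_comm])
  have : edgePoint e s ∈ S := Or.inl ⟨rfl, rfl⟩
  rw [← h] at this
  exact this

theorem eq_vertex_or_edgePoint (x : G.OneComplex) :
    (∃ v, x = vertex G v) ∨ ∃ d t, t ≠ 0 ∧ t ≠ 1 ∧ x = edgePoint d t := by
  induction x using ind with
  | hv v => exact Or.inl ⟨v, rfl⟩
  | he d t =>
    by_cases h0 : t = 0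
    · exact Or.inl ⟨_, h0 ▸ edgePoint_zero d⟩
    by_cases h1 : t = 1
    · exact Or.inl ⟨_, h1 ▸ edgePoint_one d⟩
    exact Or.inr ⟨d, t, h0, h1, rfl⟩

instance : T1Space G.OneComplex := by
  refine ⟨fun x => (isClosed_iff _).2 fun d => Set.Finite.isClosed ?_⟩
  obtain ⟨v, rfl⟩ | ⟨e, s, h0, h1, rfl⟩ := eq_vertex_or_edgePoint x
  · refine (Set.toFinite ({0, 1} : Set I)).subset fun t ht => ?_
    rcases (edgePoint_eq_vertex_iff d t v).1 ht with h | h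
    · exact Or.inl h.1
    · exact Or.inr h.1
  · refine (Set.toFinite ({s, σ s} : Set I)).subset fun t ht => ?_
    rcases edgePoint_eq_edgePoint ht h0 h1 with h | h
    · exact Or.inl h.2
    · exact Or.inr h.2

/-- Urysohn's lemma along one edge, with prescribed values at its endvertices. -/
theorem exists_edge_urysohn {A B : Set G.OneComplex} (hA : IsClosed A) (hB : IsClosed B)
    (hAB : Disjoint A B) (f : V → ℝ) (hfA : ∀ v, vertex G v ∈ A → f v = 0)
    (hfB : ∀ v, vertex G v ∈ B → f v = 1) (d : G.Dart) :
    ∃ g : C(I, ℝ), g 0 = f d.fst ∧ g 1 = f d.snd ∧ (∀ t, edgePoint d t ∈ A → g t = 0) ∧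
      ∀ t, edgePoint d t ∈ B → g t = 1 := by
  obtain ⟨k, hkA, hkB, -⟩ := exists_continuous_zero_one_of_isClosed
    ((isClosed_iff A).1 hA d) ((isClosed_iff B).1 hB d)
    (Set.disjoint_left.2 fun t ht ht' => Set.disjoint_left.1 hAB ht ht')
  have hC : IsClosed ({t : I | edgePoint d t ∈ A} ∪ {t : I | edgePoint d t ∈ B}) :=
    ((isClosed_iff A).1 hA d).union ((isClosed_iff B).1 hB d)
  -- Corrects the value of `k` at one end `e` without changing it on `A` and `B`. The two corrected
  -- functions are then interpolated linearly along the edge.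
  have corr : ∀ (e : I) (c : ℝ), (edgePoint d e ∈ A → c = 0) → (edgePoint d e ∈ B → c = 1) →
      ∃ m : C(I, ℝ), m e = c ∧
        ∀ t, edgePoint d t ∈ A ∨ edgePoint d t ∈ B → m t = k t := by
    intro e c h0 h1
    by_cases he : edgePoint d e ∈ A ∨ edgePoint d e ∈ B
    · refine ⟨k, ?_, fun _ _ => rfl⟩
      rcases he with he | he
      · rw [h0 he]; exact hkA he
      · rw [h1 he]; exact hkB he
    · obtain ⟨m, hm0, hm1, -⟩ := exists_continuous_zero_one_of_isClosed hC
        (isClosed_singleton (x := e)) (disjoint_singleton_right.2 he)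
      refine ⟨k + (c - k e) • m, ?_, fun t ht => ?_⟩
      · have : m e = 1 := hm1 rfl
        simp [this]
      · have : m t = 0 := hm0 ht
        simp [this]
  obtain ⟨m₀, h₀, h₀'⟩ := corr 0 (f d.fst) (by rw [edgePoint_zero]; exact hfA _)
    (by rw [edgePoint_zero]; exact hfB _)
  obtain ⟨m₁, h₁, h₁'⟩ := corr 1 (f d.snd) (by rw [edgePoint_one]; exact hfA _)
    (by rw [edgePoint_one]; exact hfB _)
  let c : C(I, ℝ) := ⟨fun t => (t : ℝ), continuous_subtype_val⟩
  refine ⟨(1 - c) * m₀ + c * m₁, ?_, ?_, fun t ht => ?_, fun t ht => ?_⟩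
  · simp [c, h₀]
  · simp [c, h₁]
  · have : k t = 0 := hkA ht
    simp [h₀' t (Or.inl ht), h₁' t (Or.inl ht), this]
  · have : k t = 1 := hkB ht
    simp [h₀' t (Or.inr ht), h₁' t (Or.inr ht), this]

instance : NormalSpace G.OneComplex := by
  classical
  refine ⟨fun A B hA hB hAB => ?_⟩
  let f : V → ℝ := fun v => if vertex G v ∈ B then 1 else 0
  have hfB : ∀ v, vertex G v ∈ B → f v = 1 := fun v hv => if_pos hv
  have hfA : ∀ v, vertex G v ∈ A → f v = 0 := fun v hv => if_neg (Set.disjoint_left.1 hAB hv)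
  choose g hg0 hg1 hgA hgB using exists_edge_urysohn hA hB hAB f hfA hfB
  -- The functions `g d` are chosen separately for the two orientations of an edge; averaging makes
  -- them agree.
  let F : G.OneComplex → ℝ := lift f (fun d t => (g d t + g d.symm (σ t)) / 2)
    (by intro d; simp [hg0, hg1]) (by intro d t; simp [add_comm])
  have hF : Continuous F := by
    refine continuous_iff.2 fun d => ?_
    change Continuous fun t : I => (g d t + g d.symm (σ t)) / 2
    fun_prop
  have hFA : ∀ x ∈ A, F x = 0 := by
    intro x
    induction x using ind with
    | hv v => exact hfA v
    | he d t =>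
      intro h
      change (g d t + g d.symm (σ t)) / 2 = 0
      rw [hgA d t h, hgA d.symm (σ t) (by rwa [edgePoint_symm])]
      norm_num
  have hFB : ∀ x ∈ B, F x = 1 := by
    intro x
    induction x using ind with
    | hv v => exact hfB v
    | he d t =>
      intro h
      change (g d t + g d.symm (σ t)) / 2 = 1
      rw [hgB d t h, hgB d.symm (σ t) (by rwa [edgePoint_symm])]
      norm_num
  refine ⟨F ⁻¹' Iio (1 / 2), F ⁻¹' Ioi (1 / 2), isOpen_Iio.preimage hF, isOpen_Ioi.preimage hF,
    fun x hx => ?_, fun x hx => ?_, ?_⟩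
  · simp [hFA x hx]
  · simp only [mem_preimage, hFB x hx, mem_Ioi]; norm_num
  · exact Set.disjoint_left.2 fun x hx hx' => lt_asymm (show F x < 1 / 2 from hx) hx'

end SimpleGraph.OneComplex

/-! ### Subgraphs as closed subcomplexes, and their closures in `βG` -/

namespace SimpleGraph

variable {V : Type*} {G : SimpleGraph V}

namespace Subgraph

open OneComplex unitInterval

/-- The subcomplex of the 1-complex that corresponds to a subgraph. -/
def carrier (H : G.Subgraph) : Set G.OneComplex :=
  ofTraces (· ∈ H.verts)
    (fun d t => H.Adj d.fst d.snd ∨ t = 0 ∧ d.fst ∈ H.verts ∨ t = 1 ∧ d.snd ∈ H.verts)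
    (fun d => ⟨by rintro (h | h | h); exacts [H.edge_vert h, h.2, absurd h.1 zero_ne_one],
      fun h => Or.inr (Or.inl ⟨rfl, h⟩)⟩)
    (fun d t => by simp [H.adj_comm d.fst, or_comm])

theorem vertex_mem_carrier {H : G.Subgraph} {v : V} : vertex G v ∈ H.carrier ↔ v ∈ H.verts :=
  Iff.rfl

theorem edgePoint_mem_carrier {H : G.Subgraph} {d : G.Dart} {t : I} :
    edgePoint d t ∈ H.carrier ↔
      H.Adj d.fst d.snd ∨ t = 0 ∧ d.fst ∈ H.verts ∨ t = 1 ∧ d.snd ∈ H.verts :=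
  Iff.rfl

/-- The trace on an edge of `H` is all of `[0, 1]`; on any other edge it lies in `{0, 1}`. -/
theorem isClosed_carrier (H : G.Subgraph) : IsClosed H.carrier := by
  refine (isClosed_iff _).2 fun d => ?_
  by_cases h : H.Adj d.fst d.snd
  · simp [edgePoint_mem_carrier, h]
  · refine ((Set.toFinite ({0, 1} : Set I)).subset fun t ht => ?_).isClosed
    rcases ht with ht | ht | ht
    exacts [absurd ht h, Or.inl ht.1, Or.inr ht.1]

theorem carrier_inf (H K : G.Subgraph) : (H ⊓ K).carrier = H.carrier ∩ K.carrier := by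
  ext x
  induction x using OneComplex.ind with
  | hv v => rfl
  | he d t =>
    have h1 := fun h : H.Adj d.fst d.snd => (⟨H.edge_vert h, H.edge_vert h.symm⟩ : _ ∧ _)
    have h2 := fun h : K.Adj d.fst d.snd => (⟨K.edge_vert h, K.edge_vert h.symm⟩ : _ ∧ _)
    have h3 : ¬ (t = 0 ∧ t = 1) := fun h => zero_ne_one (h.1.symm.trans h.2)
    simp only [edgePoint_mem_carrier, mem_inter_iff, inf_adj, verts_inf]
    tauto

theorem carrier_sup (H K : G.Subgraph) : (H ⊔ K).carrier = H.carrier ∪ K.carrier := by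
  ext x
  induction x using OneComplex.ind with
  | hv v => rfl
  | he d t =>
    simp only [edgePoint_mem_carrier, mem_union, sup_adj, verts_sup]
    tauto

theorem carrier_top : (⊤ : G.Subgraph).carrier = univ := by
  ext x
  induction x using OneComplex.ind with
  | hv v => simp [vertex_mem_carrier]
  | he d t => simp [edgePoint_mem_carrier, d.adj]

theorem carrier_mono {H K : G.Subgraph} (h : H ≤ K) : H.carrier ⊆ K.carrier := by
  rw [← inf_eq_left] at h
  rw [← h, carrier_inf]
  exact inter_subset_right

theorem isCompact_carrier {H : G.Subgraph} (hH : H.verts.Finite) : IsCompact H.carrier := by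
  have hfin : {d : G.Dart | H.Adj d.fst d.snd}.Finite := by
    refine Set.Finite.of_finite_image ((hH.prod hH).subset ?_)
      (Dart.toProd_injective.injOn (s := {d : G.Dart | H.Adj d.fst d.snd}))
    rintro _ ⟨d, hd, rfl⟩
    exact ⟨H.edge_vert hd, H.edge_vert hd.symm⟩
  refine IsCompact.of_isClosed_subset ((hH.image (vertex G)).isCompact.union
    (hfin.isCompact_biUnion fun d _ => isCompact_range (continuous_edgePoint d)))
    H.isClosed_carrier fun x => ?_
  induction x using OneComplex.ind with
  | hv v => exact fun h => Or.inl ⟨v, h, rfl⟩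
  | he d t =>
    rintro (h | ⟨rfl, h⟩ | ⟨rfl, h⟩)
    · exact Or.inr (mem_biUnion (x := d) h ⟨t, rfl⟩)
    · exact Or.inl ⟨_, h, (edgePoint_zero d).symm⟩
    · exact Or.inl ⟨_, h, (edgePoint_one d).symm⟩

/-- The closure in the Stone-Čech compactification of the subcomplex of a subgraph. -/
def stoneCechClosure (H : G.Subgraph) : Set (StoneCech G.OneComplex) :=
  closure (stoneCechUnit '' H.carrier)

theorem isClosed_stoneCechClosure (H : G.Subgraph) : IsClosed H.stoneCechClosure :=
  isClosed_closure

theorem stoneCechClosure_inf (H K : G.Subgraph) :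
    (H ⊓ K).stoneCechClosure = H.stoneCechClosure ∩ K.stoneCechClosure := by
  rw [stoneCechClosure, carrier_inf]
  exact closure_stoneCechUnit_image_inter H.isClosed_carrier K.isClosed_carrier

theorem stoneCechClosure_sup (H K : G.Subgraph) :
    (H ⊔ K).stoneCechClosure = H.stoneCechClosure ∪ K.stoneCechClosure := by
  rw [stoneCechClosure, carrier_sup, image_union, closure_union]; rfl

theorem stoneCechClosure_top : (⊤ : G.Subgraph).stoneCechClosure = univ := by
  rw [stoneCechClosure, carrier_top, image_univ]
  exact denseRange_stoneCechUnit.closure_range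

theorem stoneCechClosure_mono {H K : G.Subgraph} (h : H ≤ K) :
    H.stoneCechClosure ⊆ K.stoneCechClosure :=
  closure_mono (image_mono (carrier_mono h))

theorem stoneCechUnit_mem_stoneCechClosure {H : G.Subgraph} {x : G.OneComplex} :
    stoneCechUnit x ∈ H.stoneCechClosure ↔ x ∈ H.carrier :=
  stoneCechUnit_mem_closure_image H.isClosed_carrier

/-- A finite subcomplex is compact, so its image is already closed in `βG`: the remainder does not
see finite subgraphs. -/
theorem disjoint_stoneCechClosure_remainder {H : G.Subgraph} (hH : H.verts.Finite) :
    Disjoint H.stoneCechClosure G.stoneCechRemainder := by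
  have hc := (isCompact_carrier hH).image (continuous_stoneCechUnit (α := G.OneComplex))
  rw [stoneCechClosure, hc.isClosed.closure_eq]
  exact disjoint_compl_right_iff_subset.2 (image_subset_range _ _)

/-- The subgraph without edges on a set of vertices. -/
def ofVerts (G : SimpleGraph V) (A : Set V) : G.Subgraph where
  verts := A
  Adj _ _ := False
  adj_sub := False.elim
  edge_vert := False.elim
  symm := ⟨fun _ _ => id⟩

/-- The subgraph that consists of a set of vertices and all edges that meet it. -/
def incident (G : SimpleGraph V) (A : Set V) : G.Subgraph where
  verts := {w | w ∈ A ∨ ∃ a ∈ A, G.Adj a w}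
  Adj a b := G.Adj a b ∧ (a ∈ A ∨ b ∈ A)
  adj_sub h := h.1
  edge_vert h := h.2.imp id fun hb => ⟨_, hb, h.1.symm⟩
  symm := ⟨fun _ _ h => ⟨h.1.symm, h.2.symm⟩⟩

/-- The subgraph induced on a set of vertices. -/
abbrev inducedOn (G : SimpleGraph V) (A : Set V) : G.Subgraph := (⊤ : G.Subgraph).induce A

theorem carrier_incident_singleton (v : V) : (incident G {v}).carrier = star G v := by
  ext x
  constructor
  · induction x using OneComplex.ind with
    | hv w =>
      rintro (rfl | ⟨_, rfl, h⟩)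
      · exact Or.inl rfl
      · exact Or.inr ⟨⟨(_, w), h⟩, 1, rfl, (edgePoint_one (⟨(_, w), h⟩ : G.Dart)).symm⟩
    | he d t =>
      have key : ∀ w, w ∈ (incident G {v}).verts → vertex G w ∈ star G v := by
        rintro w (rfl | ⟨_, rfl, h⟩)
        · exact Or.inl rfl
        · exact Or.inr ⟨⟨(_, w), h⟩, 1, rfl, (edgePoint_one (⟨(_, w), h⟩ : G.Dart)).symm⟩
      rintro (⟨-, h | h⟩ | ⟨rfl, h⟩ | ⟨rfl, h⟩)
      · exact Or.inr ⟨d, t, h, rfl⟩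
      · exact Or.inr ⟨d.symm, σ t, h, (edgePoint_symm d t).symm⟩
      · rw [edgePoint_zero]; exact key _ h
      · rw [edgePoint_one]; exact key _ h
  · rintro (rfl | ⟨d, t, rfl, rfl⟩)
    · exact Or.inl rfl
    · exact Or.inl ⟨d.adj, Or.inl rfl⟩

theorem carrier_ofVerts (A : Set V) : (ofVerts G A).carrier = vertex G '' A := by
  ext x
  constructor
  · induction x using OneComplex.ind with
    | hv w => exact fun h => ⟨w, h, rfl⟩
    | he d t =>
      rintro (h | ⟨rfl, h⟩ | ⟨rfl, h⟩)
      · exact h.elim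
      · exact ⟨_, h, (edgePoint_zero d).symm⟩
      · exact ⟨_, h, (edgePoint_one d).symm⟩
  · rintro ⟨w, hw, rfl⟩
    exact hw

end Subgraph

/-! ### The open stars and the auxiliary remainder -/

open Subgraph

theorem stoneCechStar_eq_diff (v : V) : G.stoneCechStar v =
    (incident G {v}).stoneCechClosure \ (ofVerts G (G.neighborSet v)).stoneCechClosure := by
  rw [stoneCechStar, stoneCechClosure, stoneCechClosure, carrier_incident_singleton,
    carrier_ofVerts]
  rfl

/-- The star of `v` and `G - v` have union `G` and intersection the edgeless graph on `N(v)`; taking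
closures preserves both identities. -/
theorem stoneCechStar_eq_compl (v : V) :
    G.stoneCechStar v = (inducedOn G {v}ᶜ).stoneCechClosureᶜ := by
  have hsup : incident G {v} ⊔ inducedOn G {v}ᶜ = ⊤ := by
    ext a b
    · by_cases h : a = v <;> simp [incident, h]
    · by_cases h : a = v <;> by_cases h' : b = v <;> simp [incident, h, h']
  have hinf : incident G {v} ⊓ inducedOn G {v}ᶜ = ofVerts G (G.neighborSet v) := by
    ext a b
    · simp only [incident, ofVerts, verts_inf, mem_inter_iff, mem_ofPred_eq, mem_singleton_iff,
        induce_verts, mem_compl_iff, mem_neighborSet, exists_eq_left]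
      exact ⟨fun h => h.1.resolve_left h.2, fun h => ⟨Or.inr h, h.ne'⟩⟩
    · simp [incident, ofVerts]
      tauto
  have h1 := congrArg stoneCechClosure hsup
  have h2 := congrArg stoneCechClosure hinf
  rw [stoneCechClosure_sup, stoneCechClosure_top] at h1
  rw [stoneCechClosure_inf] at h2
  rw [stoneCechStar_eq_diff, ← h2]
  ext x
  have : x ∈ (incident G {v}).stoneCechClosure ∪ (inducedOn G {v}ᶜ).stoneCechClosure :=
    h1 ▸ mem_univ x
  simp only [mem_sdiff, mem_inter_iff, mem_compl_iff, mem_union] at this ⊢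
  tauto

theorem isOpen_stoneCechStar (v : V) : IsOpen (G.stoneCechStar v) := by
  rw [stoneCechStar_eq_compl]
  exact (isClosed_stoneCechClosure _).isOpen_compl

theorem isClosed_auxiliaryRemainder : IsClosed G.auxiliaryRemainder :=
  (isOpen_iUnion isOpen_stoneCechStar).isClosed_compl

theorem notMem_stoneCechStar {x : StoneCech G.OneComplex} (hx : x ∈ G.auxiliaryRemainder) (v : V) :
    x ∉ G.stoneCechStar v :=
  fun h => hx (mem_iUnion.2 ⟨v, h⟩)

theorem auxiliaryRemainder_subset : G.auxiliaryRemainder ⊆ G.stoneCechRemainder := by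
  rintro _ hx ⟨p, rfl⟩
  have key : ∀ v, p ∈ (inducedOn G {v}ᶜ).carrier := by
    intro v
    have := notMem_stoneCechStar hx v
    rw [stoneCechStar_eq_compl, mem_compl_iff, not_not] at this
    exact stoneCechUnit_mem_stoneCechClosure.1 this
  -- A vertex is lost when it is deleted, an inner edge point when an end of its edge is.
  obtain ⟨v, rfl⟩ | ⟨d, t, h0, h1, rfl⟩ := OneComplex.eq_vertex_or_edgePoint p
  · exact key v rfl
  · rcases key d.fst with h | h | h
    · exact h.1 rfl
    · exact h0 h.1
    · exact h1 h.1

/-- Points of the auxiliary remainder survive the deletion of finitely many vertices. -/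
theorem mem_stoneCechClosure_inducedOn_compl {X : Set V} (hX : X.Finite)
    {x : StoneCech G.OneComplex} (hx : x ∈ G.auxiliaryRemainder) :
    x ∈ (inducedOn G Xᶜ).stoneCechClosure := by
  induction X, hX using Set.Finite.induction_on with
  | empty =>
    have : inducedOn G (∅ : Set V)ᶜ = ⊤ := by ext <;> simp
    rw [this, stoneCechClosure_top]
    trivial
  | @insert v X hv hX ih =>
    have h := notMem_stoneCechStar hx v
    rw [stoneCechStar_eq_compl, mem_compl_iff, not_not] at h
    have : inducedOn G (insert v X)ᶜ = inducedOn G {v}ᶜ ⊓ inducedOn G Xᶜ := by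
      ext a b
      · simp [not_or]
      · simp [not_or]
        tauto
    rw [this, stoneCechClosure_inf]
    exact ⟨h, ih⟩

/-- If `A` and `B` partition the vertices outside a finite set and no edge joins them, then the
edges that meet `A` and the edges that meet `B` partition the remainder. -/
theorem stoneCechClosure_incident_partition {X A B : Set V} (hX : X.Finite) (hAB : Disjoint A B)
    (hXAB : Xᶜ ⊆ A ∪ B) (hE : ∀ a ∈ A, ∀ b ∈ B, ¬ G.Adj a b)
    {x : StoneCech G.OneComplex} (hx : x ∈ G.stoneCechRemainder) :
    x ∈ (incident G A).stoneCechClosure ↔ x ∉ (incident G B).stoneCechClosure := by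
  have hsup : incident G A ⊔ incident G B ⊔ inducedOn G X = ⊤ := by
    have key : ∀ a, a ∈ A ∨ a ∈ B ∨ a ∈ X := fun a => by
      by_cases h : a ∈ X
      · exact Or.inr (Or.inr h)
      · exact (hXAB h).imp id Or.inl
    ext a b
    · have := key a
      simp only [incident, verts_sup, mem_union, mem_ofPred_eq, induce_verts, verts_top, mem_univ,
        iff_true]
      tauto
    · have := key a
      have := key b
      simp only [incident, Subgraph.sup_adj, Subgraph.induce_adj, Subgraph.top_adj]
      tauto
  -- A common vertex outside `X` would give an edge between `A` and `B` or a point of both. So the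
  -- overlap is finite and invisible in the remainder, as is the graph induced on `X`.
  have hinf : (incident G A ⊓ incident G B).verts ⊆ X := by
    rintro a ⟨h1, h2⟩
    by_contra ha
    rcases hXAB ha with h | h
    · rcases h2 with h2 | ⟨b, hb, h2⟩
      · exact Set.disjoint_left.1 hAB h h2
      · exact hE a h b hb h2.symm
    · rcases h1 with h1 | ⟨b, hb, h1⟩
      · exact Set.disjoint_left.1 hAB h1 h
      · exact hE b hb a h h1
  have h1 := congrArg stoneCechClosure hsup
  rw [stoneCechClosure_sup, stoneCechClosure_sup, stoneCechClosure_top] at h1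
  have h2 := Set.disjoint_right.1 (disjoint_stoneCechClosure_remainder (hX.subset hinf)) hx
  rw [stoneCechClosure_inf] at h2
  have h3 := Set.disjoint_right.1
    (disjoint_stoneCechClosure_remainder (H := inducedOn G X) hX) hx
  have h4 : x ∈ ((incident G A).stoneCechClosure ∪ (incident G B).stoneCechClosure) ∪
    (inducedOn G X).stoneCechClosure := h1 ▸ mem_univ x
  simp only [mem_inter_iff, mem_union] at h2 h4
  tauto

end SimpleGraph

/-! ### Separating components by clopen sets (injectivity) -/

namespace SimpleGraph

variable {V : Type*} {G : SimpleGraph V}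

open Subgraph OneComplex

/-- An edge of `G - X` is connected, so it cannot pass from `O₁` to `O₂`. -/
theorem stoneCechUnit_edgePoint_mem {O₁ O₂ : Set (StoneCech G.OneComplex)} (h₁ : IsOpen O₁)
    (h₂ : IsOpen O₂) (hd : Disjoint O₁ O₂) {X : Set V}
    (hX : ∀ p ∈ (inducedOn G Xᶜ).carrier, stoneCechUnit p ∈ O₁ ∪ O₂) {d : G.Dart}
    (hf : d.fst ∉ X) (hs : d.snd ∉ X) (hd₁ : stoneCechUnit (vertex G d.fst) ∈ O₁)
    (t : unitInterval) : stoneCechUnit (edgePoint d t) ∈ O₁ := by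
  have hc : Continuous fun t => stoneCechUnit (edgePoint d t) :=
    continuous_stoneCechUnit.comp (continuous_edgePoint d)
  refine (isPreconnected_range hc).subset_left_of_subset_union h₁ h₂ hd ?_ ?_ ⟨t, rfl⟩
  · rintro _ ⟨t, rfl⟩
    exact hX _ (Or.inl ⟨hf, hs, d.adj⟩)
  · exact ⟨_, ⟨0, rfl⟩, by simpa only [edgePoint_zero] using hd₁⟩

theorem stoneCechClosure_inducedOn_subset {O₁ O₂ : Set (StoneCech G.OneComplex)} (h₁ : IsOpen O₁)
    (h₂ : IsOpen O₂) (hd : Disjoint O₁ O₂) {X : Set V}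
    (hX : ∀ p ∈ (inducedOn G Xᶜ).carrier, stoneCechUnit p ∈ O₁ ∪ O₂) :
    (inducedOn G {v | v ∉ X ∧ stoneCechUnit (vertex G v) ∈ O₁}).stoneCechClosure ⊆
      closure O₁ := by
  refine closure_mono ?_
  rintro _ ⟨p, hp, rfl⟩
  induction p using OneComplex.ind with
  | hv v => exact hp.2
  | he d t =>
    rcases hp with ⟨hf, hs, -⟩ | ⟨rfl, h⟩ | ⟨rfl, h⟩
    · exact stoneCechUnit_edgePoint_mem h₁ h₂ hd hX hf.1 hs.1 hf.2 t
    · rw [edgePoint_zero]; exact h.2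
    · rw [edgePoint_one]; exact h.2

/-- Points in different components of the auxiliary remainder are separated by a clopen subset of
the Stone-Čech remainder. -/
theorem exists_isClopen_separating {x y : G.auxiliaryRemainder}
    (hxy : (x : ConnectedComponents G.auxiliaryRemainder) ≠ y) :
    ∃ S : Set G.stoneCechRemainder, IsClopen S ∧
      ⟨x, auxiliaryRemainder_subset x.2⟩ ∈ S ∧ ⟨y, auxiliaryRemainder_subset y.2⟩ ∉ S := by
  have : CompactSpace G.auxiliaryRemainder :=
    isCompact_iff_compactSpace.1 isClosed_auxiliaryRemainder.isCompact
  obtain ⟨U, hU, hxU, hUy⟩ := compact_exists_isClopen_in_isOpen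
    (isOpen_compl_singleton (x := (y : ConnectedComponents G.auxiliaryRemainder))) hxy
  let P : Set G.auxiliaryRemainder := ConnectedComponents.mk ⁻¹' U
  have hP : IsClopen P := hU.preimage ConnectedComponents.continuous_coe
  have hyP : y ∈ Pᶜ := fun h => hUy h rfl
  have hcl := isClosed_auxiliaryRemainder (G := G)
  obtain ⟨O₁, O₂, ho₁, ho₂, hPO₁, hPO₂, hd⟩ := SeparatedNhds.of_isCompact_isCompact
    (hP.1.isCompact.image continuous_subtype_val) (hP.compl.1.isCompact.image continuous_subtype_val)
    (disjoint_image_of_injective Subtype.val_injective disjoint_compl_right)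
  -- Outside `O₁ ∪ O₂` there is no point of `G^×`, so finitely many stars cover this compact set.
  -- `X` consists of their centres.
  obtain ⟨X, hX⟩ := (ho₁.union ho₂).isClosed_compl.isCompact.elim_finite_subcover
    (fun v => G.stoneCechStar v) isOpen_stoneCechStar (by
      intro z hz
      by_contra hz'
      have hz' : z ∈ G.auxiliaryRemainder := hz'
      by_cases hzP : (⟨z, hz'⟩ : G.auxiliaryRemainder) ∈ P
      · exact hz (Or.inl (hPO₁ ⟨_, hzP, rfl⟩))
      · exact hz (Or.inr (hPO₂ ⟨_, hzP, rfl⟩)))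
  have hXO : ∀ p ∈ (inducedOn G (X : Set V)ᶜ).carrier, stoneCechUnit p ∈ O₁ ∪ O₂ := by
    intro p hp
    by_contra hpO
    obtain ⟨v, hv, hpv⟩ := mem_iUnion₂.1 (hX hpO)
    rw [stoneCechStar_eq_compl] at hpv
    refine hpv (stoneCechUnit_mem_stoneCechClosure.2 (carrier_mono ?_ hp))
    exact induce_mono_right (compl_subset_compl.2 (singleton_subset_iff.2 hv))
  have hXO' : ∀ p ∈ (inducedOn G (X : Set V)ᶜ).carrier, stoneCechUnit p ∈ O₂ ∪ O₁ :=
    fun p hp => (hXO p hp).symm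
  set A : Set V := {v | v ∉ (X : Set V) ∧ stoneCechUnit (vertex G v) ∈ O₁} with hA
  set B : Set V := {v | v ∉ (X : Set V) ∧ stoneCechUnit (vertex G v) ∈ O₂} with hB
  have hXAB : (X : Set V)ᶜ ⊆ A ∪ B :=
    fun v hv => (hXO (vertex G v) hv).imp (fun h => ⟨hv, h⟩) fun h => ⟨hv, h⟩
  have hAB : Disjoint A B := Set.disjoint_left.2 fun v h h' => Set.disjoint_left.1 hd h.2 h'.2
  have hE : ∀ a ∈ A, ∀ b ∈ B, ¬ G.Adj a b := by
    intro a ha b hb hab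
    have := stoneCechUnit_edgePoint_mem ho₁ ho₂ hd hXO (d := ⟨(a, b), hab⟩) ha.1 hb.1 ha.2 1
    rw [edgePoint_one] at this
    exact Set.disjoint_left.1 hd this hb.2
  have hsup : inducedOn G (X : Set V)ᶜ ≤ inducedOn G A ⊔ inducedOn G B := by
    refine ⟨hXAB, fun a b h => ?_⟩
    rcases hXAB h.1, hXAB h.2.1 with ⟨ha | ha, hb | hb⟩
    · exact Or.inl ⟨ha, hb, h.2.2⟩
    · exact (hE _ ha _ hb h.2.2).elim
    · exact (hE _ hb _ ha h.2.2.symm).elim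
    · exact Or.inr ⟨ha, hb, h.2.2⟩
  have hmem : ∀ z ∈ G.auxiliaryRemainder,
      z ∈ (inducedOn G A).stoneCechClosure ∪ (inducedOn G B).stoneCechClosure := by
    intro z hz
    rw [← stoneCechClosure_sup]
    exact stoneCechClosure_mono hsup (mem_stoneCechClosure_inducedOn_compl X.finite_toSet hz)
  have hle : ∀ C : Set V, inducedOn G C ≤ incident G C :=
    fun C => ⟨fun v hv => Or.inl hv, fun a b h => ⟨h.2.2, Or.inl h.1⟩⟩
  have hpart := fun z : G.stoneCechRemainder =>
    stoneCechClosure_incident_partition X.finite_toSet hAB hXAB hE z.2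
  -- Induced subgraphs would omit the edges between `X` and `A ∪ B`, along which the remainder may
  -- have points; with all incident edges, the two closures partition it.
  refine ⟨Subtype.val ⁻¹' (incident G A).stoneCechClosure,
    ⟨(isClosed_stoneCechClosure _).preimage continuous_subtype_val, ?_⟩, ?_, ?_⟩
  · have : (Subtype.val ⁻¹' (incident G A).stoneCechClosure : Set G.stoneCechRemainder) =
        (Subtype.val ⁻¹' (incident G B).stoneCechClosure)ᶜ := Set.ext hpart
    rw [this]
    exact ((isClosed_stoneCechClosure _).preimage continuous_subtype_val).isOpen_compl
  · refine stoneCechClosure_mono (hle A) ((hmem x x.2).resolve_right fun h => ?_)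
    exact Set.disjoint_left.1 (hd.closure_right ho₁) (hPO₁ ⟨x, hxU, rfl⟩)
      (stoneCechClosure_inducedOn_subset ho₂ ho₁ hd.symm hXO' h)
  · intro h
    refine (hpart ⟨y, auxiliaryRemainder_subset y.2⟩).1 h (stoneCechClosure_mono (hle B)
      ((hmem y y.2).resolve_left fun h => ?_))
    exact Set.disjoint_left.1 (hd.symm.closure_right ho₂) (hPO₂ ⟨y, hyP, rfl⟩)
      (stoneCechClosure_inducedOn_subset ho₁ ho₂ hd hXO h)

end SimpleGraph

/-! ### Final segments of the edges at a vertex (surjectivity) -/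

namespace SimpleGraph

variable {V : Type*} {G : SimpleGraph V}

namespace OneComplex

open unitInterval

/-- The union, over the neighbours `w ∈ J` of `v`, of the final segments `[ε w, 1]` of the edges
from `v` to `w`. -/
def tail (v : V) (ε : V → I) (hε : ∀ w, 0 < ε w) (J : Set V) : Set G.OneComplex :=
  ofTraces (fun w => G.Adj v w ∧ w ∈ J)
    -- The first two disjuncts give the segment in both orientations of its edge; the last two
    -- record its endvertex `w` as a point of the other edges at `w`.
    (fun d t => (d.fst = v ∧ d.snd ∈ J ∧ ε d.snd ≤ t ∨ d.snd = v ∧ d.fst ∈ J ∧ ε d.fst ≤ σ t) ∨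
      t = 0 ∧ G.Adj v d.fst ∧ d.fst ∈ J ∨ t = 1 ∧ G.Adj v d.snd ∧ d.snd ∈ J)
    (fun d => by
      constructor
      · rintro ((⟨-, -, h⟩ | ⟨rfl, h, -⟩) | h | h)
        · exact absurd h (hε _).not_ge
        · exact ⟨d.adj.symm, h⟩
        · exact h.2
        · exact absurd h.1 zero_ne_one
      · exact fun h => Or.inr (Or.inl ⟨rfl, h⟩))
    (fun d t => by simp [or_comm])

variable {v : V} {ε : V → I} {hε : ∀ w, 0 < ε w}

theorem vertex_mem_tail {J : Set V} {w : V} :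
    vertex G w ∈ tail v ε hε J ↔ G.Adj v w ∧ w ∈ J :=
  Iff.rfl

/-- Closedness is tested edge by edge, so the `ε w` need no common positive lower bound. -/
theorem isClosed_tail (J : Set V) : IsClosed (tail (G := G) v ε hε J) := by
  refine (isClosed_iff _).2 fun d => ?_
  have h0 (c : Prop) : IsClosed {_t : I | c} := isClosed_const
  have h1 : IsClosed {t : I | d.fst = v ∧ d.snd ∈ J ∧ ε d.snd ≤ t} :=
    (h0 _).inter ((h0 _).inter isClosed_Ici)
  have h2 : IsClosed {t : I | d.snd = v ∧ d.fst ∈ J ∧ ε d.fst ≤ σ t} :=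
    (h0 _).inter ((h0 _).inter (isClosed_Ici.preimage continuous_symm))
  have h3 : IsClosed {t : I | t = 0 ∧ G.Adj v d.fst ∧ d.fst ∈ J} :=
    (isClosed_eq continuous_id continuous_const).inter (h0 _)
  have h4 : IsClosed {t : I | t = 1 ∧ G.Adj v d.snd ∧ d.snd ∈ J} :=
    (isClosed_eq continuous_id continuous_const).inter (h0 _)
  exact (h1.union h2).union (h3.union h4)

theorem tail_mono {J J' : Set V} (h : J ⊆ J') :
    tail (G := G) v ε hε J ⊆ tail v ε hε J' := by
  intro x
  induction x using OneComplex.ind with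
  | hv w => exact fun hw => ⟨hw.1, h hw.2⟩
  | he d t =>
    exact Or.imp (Or.imp (fun k => ⟨k.1, h k.2.1, k.2.2⟩) fun k => ⟨k.1, h k.2.1, k.2.2⟩)
      (Or.imp (fun k => ⟨k.1, k.2.1, h k.2.2⟩) fun k => ⟨k.1, k.2.1, h k.2.2⟩)

theorem tail_union (J J' : Set V) :
    tail (G := G) v ε hε (J ∪ J') = tail v ε hε J ∪ tail v ε hε J' := by
  refine Subset.antisymm (fun x => ?_)
    (union_subset (tail_mono subset_union_left) (tail_mono subset_union_right))
  induction x using OneComplex.ind with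
  | hv w => exact fun h => h.2.imp (fun k => ⟨h.1, k⟩) fun k => ⟨h.1, k⟩
  | he d t =>
    rintro ((⟨h, k | k, h'⟩ | ⟨h, k | k, h'⟩) | ⟨h, h', k | k⟩ | ⟨h, h', k | k⟩)
    · exact Or.inl (Or.inl (Or.inl ⟨h, k, h'⟩))
    · exact Or.inr (Or.inl (Or.inl ⟨h, k, h'⟩))
    · exact Or.inl (Or.inl (Or.inr ⟨h, k, h'⟩))
    · exact Or.inr (Or.inl (Or.inr ⟨h, k, h'⟩))
    · exact Or.inl (Or.inr (Or.inl ⟨h, h', k⟩))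
    · exact Or.inr (Or.inr (Or.inl ⟨h, h', k⟩))
    · exact Or.inl (Or.inr (Or.inr ⟨h, h', k⟩))
    · exact Or.inr (Or.inr (Or.inr ⟨h, h', k⟩))

/-- Two edges at `v` to different neighbours meet only in `v`, which the segments avoid because `ε`
is positive. -/
theorem disjoint_tail {J J' : Set V} (h : Disjoint J J') :
    Disjoint (tail (G := G) v ε hε J) (tail v ε hε J') := by
  refine Set.disjoint_left.2 fun x => ?_
  have hJ : ∀ w, w ∈ J → w ∉ J' := fun w hw => Set.disjoint_left.1 h hw
  induction x using OneComplex.ind with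
  | hv w => exact fun h h' => hJ w h.2 h'.2
  | he d t =>
    have h1 : ¬ (d.fst = v ∧ d.snd = v) := fun h => d.adj.ne (h.1.trans h.2.symm)
    have h2 : ¬ (t = 0 ∧ t = 1) := fun h => zero_ne_one (h.1.symm.trans h.2)
    have h3 : ¬ (t = 0 ∧ ε d.snd ≤ t) := by rintro ⟨rfl, h⟩; exact (hε _).not_ge h
    have h4 : ¬ (t = 1 ∧ ε d.fst ≤ σ t) := by
      rintro ⟨rfl, h⟩; rw [symm_one] at h; exact (hε _).not_ge h
    have h5 : d.fst = v → ¬ G.Adj v d.fst := fun h => h ▸ G.irrefl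
    have h6 : d.snd = v → ¬ G.Adj v d.snd := fun h => h ▸ G.irrefl
    rintro ((a | a) | a | a) ((b | b) | b | b) <;> grind

theorem tail_singleton {w : V} (h : G.Adj v w) :
    tail v ε hε {w} = edgePoint (⟨(v, w), h⟩ : G.Dart) '' Icc (ε w) 1 := by
  ext x
  constructor
  · have hw : vertex G w ∈ edgePoint (⟨(v, w), h⟩ : G.Dart) '' Icc (ε w) 1 :=
      ⟨1, ⟨le_one', le_rfl⟩, edgePoint_one _⟩
    induction x using OneComplex.ind with
    | hv w => rintro ⟨-, rfl⟩; exact hw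
    | he d t =>
      obtain ⟨⟨a, b⟩, hab⟩ := d
      rintro ((⟨rfl, rfl, ht⟩ | ⟨rfl, rfl, ht⟩) | ⟨rfl, -, rfl⟩ | ⟨rfl, -, rfl⟩)
      · exact ⟨t, ⟨ht, le_one'⟩, rfl⟩
      · exact ⟨σ t, ⟨ht, le_one'⟩, edgePoint_symm (⟨(_, _), hab⟩ : G.Dart) t⟩
      · rw [edgePoint_zero]; exact hw
      · rw [edgePoint_one]; exact hw
  · rintro ⟨t, ht, rfl⟩
    exact Or.inl (Or.inl ⟨rfl, rfl, ht.1⟩)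

theorem exists_mem_tail_singleton {J : Set V} {x : G.OneComplex} (hx : x ∈ tail v ε hε J) :
    ∃ w, G.Adj v w ∧ x ∈ tail v ε hε {w} := by
  induction x using OneComplex.ind with
  | hv w => exact ⟨w, hx.1, hx.1, rfl⟩
  | he d t =>
    rcases hx with (⟨rfl, -, h⟩ | ⟨rfl, -, h⟩) | ⟨h, h', -⟩ | ⟨h, h', -⟩
    · exact ⟨_, d.adj, Or.inl (Or.inl ⟨rfl, rfl, h⟩)⟩
    · exact ⟨_, d.adj.symm, Or.inl (Or.inr ⟨rfl, rfl, h⟩)⟩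
    · exact ⟨_, h', Or.inr (Or.inl ⟨h, h', rfl⟩)⟩
    · exact ⟨_, h', Or.inr (Or.inr ⟨h, h', rfl⟩)⟩

theorem isPreconnected_tail_singleton {w : V} (h : G.Adj v w) :
    IsPreconnected (tail (G := G) v ε hε {w}) := by
  rw [tail_singleton h]
  exact isPreconnected_Icc.image _ (continuous_edgePoint _).continuousOn

theorem isCompact_tail_singleton {w : V} (h : G.Adj v w) :
    IsCompact (tail (G := G) v ε hε {w}) := by
  rw [tail_singleton h]
  exact isCompact_Icc.image (continuous_edgePoint _)

/-- A point of the Stone-Čech compactification other than the vertex `v` that lies in the closure of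
the star of `v` lies in the closure of the final segments of the edges at `v`. -/
theorem exists_mem_closure_tail {x : StoneCech G.OneComplex}
    (hx : x ∈ closure (stoneCechUnit '' star G v)) (hxv : x ≠ stoneCechUnit (vertex G v)) :
    ∃ (ε : V → I) (hε : ∀ w, 0 < ε w), x ∈ closure (stoneCechUnit '' tail (G := G) v ε hε univ) := by
  obtain ⟨N, hN, hNc, hNs⟩ := exists_mem_nhds_isClosed_subset
    (isOpen_compl_singleton.mem_nhds hxv)
  have hvN : stoneCechUnit (vertex G v) ∉ N := fun h => hNs h rfl
  -- `N` is a closed neighbourhood of `x` without `v`, so on each edge at `v` it misses an initial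
  -- piece `[0, ε)`.
  have key : ∀ w, ∃ ε : I, 0 < ε ∧ ∀ (h : G.Adj v w) (t : I),
      stoneCechUnit (edgePoint (⟨(v, w), h⟩ : G.Dart) t) ∈ N → ε ≤ t := by
    intro w
    by_cases h : G.Adj v w
    · have ho : IsOpen {t : I | stoneCechUnit (edgePoint (⟨(v, w), h⟩ : G.Dart) t) ∈ N}ᶜ :=
        (hNc.preimage (continuous_stoneCechUnit.comp (continuous_edgePoint _))).isOpen_compl
      have h0 : (0 : I) ∈ {t : I | stoneCechUnit (edgePoint (⟨(v, w), h⟩ : G.Dart) t) ∈ N}ᶜ := by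
        intro h0
        rw [mem_ofPred_eq, edgePoint_zero] at h0
        exact hvN h0
      obtain ⟨ε, hε, hs⟩ := exists_Ico_subset_of_mem_nhds (ho.mem_nhds h0) ⟨1, zero_lt_one⟩
      refine ⟨ε, hε, fun _ t ht => ?_⟩
      by_contra hlt
      exact hs ⟨nonneg', not_le.1 hlt⟩ ht
    · exact ⟨1, zero_lt_one, fun h' => absurd h' h⟩
  choose ε hε hεN using key
  refine ⟨ε, hε, mem_closure_iff_nhds.2 fun U hU => ?_⟩
  obtain ⟨_, ⟨hpU, hpN⟩, p, hp, rfl⟩ := mem_closure_iff_nhds.1 hx _ (Filter.inter_mem hU hN)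
  refine ⟨_, hpU, p, ?_, rfl⟩
  rcases hp with rfl | ⟨⟨⟨a, b⟩, hab⟩, t, rfl, rfl⟩
  · exact absurd hpN hvN
  · exact Or.inl (Or.inl ⟨rfl, trivial, hεN _ _ _ hpN⟩)

end OneComplex

open OneComplex Subgraph

section Tail

variable {v : V} {ε : V → unitInterval} {hε : ∀ w, 0 < ε w}

/-- A single segment is compact, and the closure of the union of the others is disjoint from it. -/
theorem isClopen_tail_singleton {w : V} (h : G.Adj v w) :
    IsClopen (Subtype.val ⁻¹' (stoneCechUnit '' tail v ε hε {w}) :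
      Set (closure (stoneCechUnit '' tail (G := G) v ε hε univ))) := by
  have hc := ((isCompact_tail_singleton (hε := hε) h).image continuous_stoneCechUnit).isClosed
  have hd := disjoint_closure_stoneCechUnit_image (isClosed_tail (G := G) (v := v) (hε := hε) {w})
    (isClosed_tail (hε := hε) {w}ᶜ) (disjoint_tail disjoint_compl_right)
  have hu : closure (stoneCechUnit '' tail (G := G) v ε hε univ) =
      closure (stoneCechUnit '' tail (G := G) v ε hε {w}) ∪
        closure (stoneCechUnit '' tail (G := G) v ε hε {w}ᶜ) := by
    rw [← closure_union, ← image_union, ← tail_union, union_compl_self]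
  refine ⟨hc.preimage continuous_subtype_val, ?_⟩
  have : (Subtype.val ⁻¹' (stoneCechUnit '' tail v ε hε {w}) :
      Set (closure (stoneCechUnit '' tail (G := G) v ε hε univ))) =
      (Subtype.val ⁻¹' closure (stoneCechUnit '' tail (G := G) v ε hε {w}ᶜ))ᶜ := by
    ext ⟨z, hz⟩
    rw [hu, hc.closure_eq] at hz
    rw [hc.closure_eq] at hd
    exact ⟨fun h h' => Set.disjoint_left.1 hd h h', fun h => hz.resolve_right h⟩
  rw [this]
  exact (isClosed_closure.preimage continuous_subtype_val).isOpen_compl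

/-- If the component contained a point of `G`, it would lie within the clopen segment through that
point, and then `x` would be in `G`. -/
theorem image_connectedComponent_tail_subset
    {x : closure (stoneCechUnit '' tail (G := G) v ε hε univ)}
    (hx : (x : StoneCech G.OneComplex) ∈ G.stoneCechRemainder) :
    Subtype.val '' connectedComponent x ⊆ G.stoneCechRemainder := by
  rintro _ ⟨q, hq, rfl⟩ ⟨p, hp⟩
  have hpT := q.2
  rw [← hp, stoneCechUnit_mem_closure_image (isClosed_tail _)] at hpT
  obtain ⟨w, hw, hpw⟩ := exists_mem_tail_singleton hpT
  obtain ⟨p', -, hp'⟩ := isPreconnected_connectedComponent.subset_isClopen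
    (isClopen_tail_singleton hw) ⟨q, hq, p, hpw, hp⟩ mem_connectedComponent
  exact hx ⟨p', hp'⟩

theorem exists_mem_connectedComponent_tail
    (x : closure (stoneCechUnit '' tail (G := G) v ε hε univ)) :
    ∃ y ∈ connectedComponent x,
      (y : StoneCech G.OneComplex) ∈ (ofVerts G (G.neighborSet v)).stoneCechClosure := by
  have : CompactSpace (closure (stoneCechUnit '' tail (G := G) v ε hε univ)) :=
    isCompact_iff_compactSpace.1 isClosed_closure.isCompact
  let F : Set (closure (stoneCechUnit '' tail (G := G) v ε hε univ)) :=
    Subtype.val ⁻¹' (ofVerts G (G.neighborSet v)).stoneCechClosure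
  have hF : IsClosed F := (isClosed_stoneCechClosure _).preimage continuous_subtype_val
  have hF' : IsClosed (ConnectedComponents.mk '' F) :=
    (hF.isCompact.image ConnectedComponents.continuous_coe).isClosed
  suffices h : ConnectedComponents.mk x ∈ ConnectedComponents.mk '' F by
    obtain ⟨y, hy, hyx⟩ := h
    exact ⟨y, ConnectedComponents.coe_eq_coe'.1 hyx, hy⟩
  -- Otherwise a clopen set containing `x` misses the closure of `N(v)`. It contains a point of some
  -- segment, hence the whole segment with its end in `N(v)`.
  by_contra hx
  obtain ⟨U, hU, hxU, hUF⟩ := compact_exists_isClopen_in_isOpen hF'.isOpen_compl hx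
  have hZ : IsClopen (ConnectedComponents.mk ⁻¹' U) := hU.preimage ConnectedComponents.continuous_coe
  obtain ⟨W, hW, hWZ⟩ := isOpen_induced_iff.1 hZ.2
  have hxW : x ∈ (Subtype.val ⁻¹' W : Set (closure (stoneCechUnit '' tail v ε hε univ))) :=
    hWZ ▸ hxU
  obtain ⟨_, hpW, p, hp, rfl⟩ := mem_closure_iff.1 x.2 W hW hxW
  obtain ⟨w, hw, hpw⟩ := exists_mem_tail_singleton hp
  have hsub : stoneCechUnit '' tail (G := G) v ε hε {w} ⊆
      closure (stoneCechUnit '' tail (G := G) v ε hε univ) := by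
    refine subset_trans (image_mono (tail_mono (subset_univ _))) subset_closure
  have hpre : IsPreconnected (Subtype.val ⁻¹' (stoneCechUnit '' tail v ε hε {w}) :
      Set (closure (stoneCechUnit '' tail (G := G) v ε hε univ))) := by
    rw [← IsInducing.subtypeVal.isPreconnected_image, Subtype.image_preimage_val,
      inter_eq_right.2 hsub]
    exact (isPreconnected_tail_singleton hw).image _ continuous_stoneCechUnit.continuousOn
  have hwmem : stoneCechUnit (vertex G w) ∈ stoneCechUnit '' tail (G := G) v ε hε {w} :=
    ⟨_, vertex_mem_tail.2 ⟨hw, rfl⟩, rfl⟩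
  have hwZ : (⟨stoneCechUnit (vertex G w), hsub hwmem⟩ :
      closure (stoneCechUnit '' tail (G := G) v ε hε univ)) ∈ ConnectedComponents.mk ⁻¹' U := by
    refine hpre.subset_isClopen hZ ⟨⟨stoneCechUnit p, hsub ⟨p, hpw, rfl⟩⟩, ⟨p, hpw, rfl⟩, ?_⟩ hwmem
    rw [← hWZ]
    exact hpW
  exact hUF hwZ ⟨_, stoneCechUnit_mem_stoneCechClosure.2 hw, rfl⟩

end Tail

/-- The star of `w` meets a set of vertices only in `{w} ∪ N(w)`. The closure of `{w}` has no point
in the remainder, and that of `N(w)` is excluded from `O(w)`. -/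
theorem mem_auxiliaryRemainder_of_mem_closure_vertices {A : Set V} {x : StoneCech G.OneComplex}
    (hx : x ∈ G.stoneCechRemainder) (hxA : x ∈ (ofVerts G A).stoneCechClosure) :
    x ∈ G.auxiliaryRemainder := by
  intro h
  obtain ⟨w, hw⟩ := mem_iUnion.1 h
  rw [stoneCechStar_eq_diff] at hw
  have hle : ofVerts G A ⊓ incident G {w} ≤ ofVerts G {w} ⊔ ofVerts G (G.neighborSet w) := by
    refine ⟨?_, fun a b h => h.1.elim⟩
    rintro a ⟨-, h | ⟨_, rfl, h⟩⟩
    · exact Or.inl h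
    · exact Or.inr h
  have hxw : x ∈ (ofVerts G A ⊓ incident G {w}).stoneCechClosure := by
    rw [stoneCechClosure_inf]
    exact ⟨hxA, hw.1⟩
  have := stoneCechClosure_mono hle hxw
  rw [stoneCechClosure_sup] at this
  rcases this with h | h
  · exact Set.disjoint_left.1
      (disjoint_stoneCechClosure_remainder (H := ofVerts G {w}) (finite_singleton w)) h hx
  · exact hw.2 h

/-- Every component of the Stone-Čech remainder meets the auxiliary remainder. -/
theorem exists_auxiliaryRemainder_mk_eq (x : G.stoneCechRemainder) :
    ∃ a : G.auxiliaryRemainder,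
      (⟨a, auxiliaryRemainder_subset a.2⟩ : G.stoneCechRemainder) ∈ connectedComponent x := by
  by_cases hx : (x : StoneCech G.OneComplex) ∈ G.auxiliaryRemainder
  · exact ⟨⟨x, hx⟩, mem_connectedComponent⟩
  obtain ⟨v, hv⟩ := mem_iUnion.1 (not_not.1 hx)
  obtain ⟨ε, hε, hxT⟩ := exists_mem_closure_tail hv.1 (fun h => x.2 ⟨_, h.symm⟩)
  have hsub := image_connectedComponent_tail_subset (hε := hε) (x := ⟨x.1, hxT⟩) x.2
  obtain ⟨y, hyD, hy⟩ := exists_mem_connectedComponent_tail ⟨x.1, hxT⟩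
  have hyR : (y : StoneCech G.OneComplex) ∈ G.stoneCechRemainder := hsub ⟨y, hyD, rfl⟩
  refine ⟨⟨y, mem_auxiliaryRemainder_of_mem_closure_vertices hyR hy⟩, ?_⟩
  have hpre : IsPreconnected (Subtype.val ⁻¹' (Subtype.val '' connectedComponent
      (⟨x.1, hxT⟩ : closure (stoneCechUnit '' tail (G := G) v ε hε univ))) :
      Set G.stoneCechRemainder) := by
    rw [← IsInducing.subtypeVal.isPreconnected_image, Subtype.image_preimage_val,
      inter_eq_right.2 hsub]
    exact isPreconnected_connectedComponent.image _ continuous_subtype_val.continuousOn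
  exact hpre.subset_connectedComponent ⟨_, mem_connectedComponent, rfl⟩ ⟨y, hyD, rfl⟩

end SimpleGraph

/-! ### The homeomorphism -/

open SimpleGraph in
theorem theorem5p17 {V : Type*} (G : SimpleGraph V) :
    G.auxiliaryRemainder ⊆ G.stoneCechRemainder ∧
    (∃ φ : ConnectedComponents G.auxiliaryRemainder ≃ₜ ConnectedComponents G.stoneCechRemainder,
      ∀ C : ConnectedComponents G.auxiliaryRemainder, C.toSetIn ⊆ (φ C).toSetIn) ∧
    T2Space (ConnectedComponents G.auxiliaryRemainder) ∧
    T2Space (ConnectedComponents G.stoneCechRemainder) := by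
  have : CompactSpace G.auxiliaryRemainder :=
    isCompact_iff_compactSpace.1 isClosed_auxiliaryRemainder.isCompact
  have hi : Continuous (inclusion (auxiliaryRemainder_subset (G := G))) := continuous_inclusion _
  let f := hi.connectedComponentsMap
  have hf : Continuous f := hi.connectedComponentsMap_continuous
  have hmk : ∀ a, f (ConnectedComponents.mk a) = ConnectedComponents.mk (inclusion _ a) :=
    fun _ => rfl
  have hsurj : Function.Surjective f := by
    intro c
    obtain ⟨x, rfl⟩ := ConnectedComponents.surjective_coe c
    obtain ⟨a, ha⟩ := exists_auxiliaryRemainder_mk_eq x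
    exact ⟨a, ConnectedComponents.coe_eq_coe'.2 ha⟩
  -- Separating the images by a continuous map on the target yields both injectivity of `f` and,
  -- with surjectivity, the Hausdorff property of the target.
  have hsep : ∀ c c' : ConnectedComponents G.auxiliaryRemainder, c ≠ c' →
      ∃ g : ConnectedComponents G.stoneCechRemainder → Bool, Continuous g ∧ g (f c) ≠ g (f c') := by
    intro c c' hcc'
    obtain ⟨x, rfl⟩ := ConnectedComponents.surjective_coe c
    obtain ⟨y, rfl⟩ := ConnectedComponents.surjective_coe c'
    obtain ⟨S, hS, hxS, hyS⟩ := exists_isClopen_separating hcc'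
    have hb : Continuous S.boolIndicator := (continuous_boolIndicator_iff_isClopen S).2 hS
    refine ⟨hb.connectedComponentsLift, hb.connectedComponentsLift_continuous, ?_⟩
    rw [hmk, hmk, hb.connectedComponentsLift_apply_coe, hb.connectedComponentsLift_apply_coe]
    have h1 := (S.mem_iff_boolIndicator _).1 hxS
    have h2 := (S.notMem_iff_boolIndicator _).1 hyS
    exact fun h => Bool.false_ne_true (h2.symm.trans (h.symm.trans h1))
  have hinj : Function.Injective f := by
    intro c c' h
    by_contra hne
    obtain ⟨g, -, hg⟩ := hsep c c' hne
    exact hg (congrArg g h)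
  have hT2 : T2Space (ConnectedComponents G.stoneCechRemainder) := by
    refine ⟨fun p q hpq => ?_⟩
    obtain ⟨c, rfl⟩ := hsurj p
    obtain ⟨c', rfl⟩ := hsurj q
    obtain ⟨g, hg, hne⟩ := hsep c c' (fun h => hpq (congrArg f h))
    exact separated_by_continuous hg hne
  refine ⟨auxiliaryRemainder_subset,
    ⟨hf.homeoOfEquivCompactToT2 (f := Equiv.ofBijective f ⟨hinj, hsurj⟩), ?_⟩, inferInstance, hT2⟩
  rintro C _ ⟨a, rfl, rfl⟩
  exact ⟨inclusion auxiliaryRemainder_subset a, rfl, rfl⟩
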